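/- All spaces are Hausdorff. A space is cosmic if it has a countable network. An $r$-skeleton on a space $X$ is a family $\{r_s:s\in\Gamma\}$ of retractions in $X$ (continuous maps $r_s:X\to X$ with $r_s\circ r_s=r_s$), indexed by a nonempty up-directed partially ordered set $\Gamma$ in which every increasing sequence has a supremum, such that (i) each $r_s(X)$ is cosmic; (ii) $r_s=r_s\circ r_t=r_t\circ r_s$ whenever $s\le t$; (iii) if $s_0\le s_1\le\cdots$ in $\Gamma$ and $s=\sup_n s_n$, then $r_s(x)=\lim_{n\to\infty}r_{s_n}(x)$ for every $x\in X$; (iv) $x=\lim_{s\in\Gamma}r_s(x)$ for every $x\in X$. Its induced space is $\bigcup_{s\in\Gamma}r_s(X)$. The Alexandroff duplicate $AD(X)$ is $X\times\{0,1\}$ with the topology in which all points of $X\times\{1\}$ are isolated and the basic neighbourhoods of $(x,0)$ are the sets $(U\times\{0,1\})\setminus\{(x,1)\}$, $U$ a neighbourhood of $x$ in $X$. Put $X_0=X\times\{0\}$ and let $\pi:AD(X)\to X$ be the projection. A subset $A$ of a compact space $X$ is a $\Sigma$-subset if there are a set $J$ and a homeomorphic embedding $h:X\to\mathbb R^J$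 such that $h(A)=h(X)\cap\Sigma(J)$, where $\Sigma(J)=\{f\in\mathbb R^J:\{j:f(j)\ne0\}\text{ is countable}\}$. A compact space $X$ is Corson if it embeds homeomorphically into $\Sigma(J)$ for some $J$, and super Valdivia if every point of $X$ lies in a dense $\Sigma$-subset of $X$. **Corollary.** Let $X$ be a compact space such that $AD(X)$ admits an $r$-skeleton, let $\hat Y$ be the induced space of such an $r$-skeleton on $AD(X)$, and put $Y=\pi(\hat Y\cap X_0)$. Then $Y$ is the induced space of some $r$-skeleton on $X$, and if $Y'$ is the induced space of an arbitrary $r$-skeleton on $X$, then $Y'=Y$. Consequently, if $X$ is not Corson, then $X$ is not super Valdivia. In particular, $AD([0,1]^{\kappa})$ does not admit an $r$-skeleton for any cardinal $\kappa\ge\omega_1$. -/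

import Mathlib

universe u v w

/-- `N` is a network of the space `X`: for every point `x` and every open `U` containing `x`,
some member of `N` contains `x` and is contained in `U`. -/
def IsNetwork {X : Type u} [TopologicalSpace X] (N : Set (Set X)) : Prop :=
  ∀ (x : X) (U : Set X), IsOpen U → x ∈ U → ∃ A ∈ N, x ∈ A ∧ A ⊆ U

/-- A space is cosmic if it has a countable network. -/
def IsCosmic (X : Type u) [TopologicalSpace X] : Prop :=
  ∃ N : Set (Set X), N.Countable ∧ IsNetwork N

/-- A retraction in `X`: a continuous idempotent self-map of `X`. -/
def IsRetractionMap {X : Type u} [TopologicalSpace X] (f : X → X) : Prop :=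
  Continuous f ∧ ∀ x, f (f x) = f x

/-- The family `r`, indexed by the partially ordered set `Γ`, is an `r`-skeleton on `X`. -/
structure IsRSkeleton {X : Type u} [TopologicalSpace X] {Γ : Type v} [PartialOrder Γ]
    (r : Γ → X → X) : Prop where
  /-- the index set is nonempty -/
  nonempty : Nonempty Γ
  /-- the index set is up-directed -/
  directed : ∀ s t : Γ, ∃ a : Γ, s ≤ a ∧ t ≤ a
  /-- the index set is `σ`-complete -/
  sigma_complete : ∀ s : ℕ → Γ, Monotone s → ∃ a : Γ, IsLUB (Set.range s) a
  /-- every member of the family is a retraction -/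
  retraction : ∀ s : Γ, IsRetractionMap (r s)
  /-- (i) the images are cosmic -/
  cosmic : ∀ s : Γ, IsCosmic (Set.range (r s))
  /-- (ii) the retractions are compatible -/
  compatible : ∀ s t : Γ, s ≤ t → r s ∘ r t = r s ∧ r t ∘ r s = r s
  /-- (iii) the family is continuous along increasing sequences -/
  tendsto_seq : ∀ (s : ℕ → Γ) (a : Γ), Monotone s → IsLUB (Set.range s) a →
    ∀ x : X, Filter.Tendsto (fun n => r (s n) x) Filter.atTop (nhds (r a x))
  /-- (iv) the net of the retractions converges pointwise to the identity -/
  tendsto_id : ∀ x : X, Filter.Tendsto (fun s : Γ => r s x) Filter.atTop (nhds x)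

/-- The subspace of `X` induced by a family of self-maps: the union of their images. -/
def inducedSubspace {X : Type u} {Γ : Type v} (r : Γ → X → X) : Set X :=
  ⋃ s, Set.range (r s)

/-- The underlying set `X × {0, 1}` of the Alexandroff duplicate of `X`
(`false` stands for `0`, `true` stands for `1`). -/
@[ext]
structure AlexandroffDuplicate (X : Type u) : Type u where
  /-- the first coordinate, in `X` -/
  point : X
  /-- the second coordinate, in `{0, 1}` -/
  level : Bool

namespace AlexandroffDuplicate

/-- The projection `π` of the duplicate onto `X`. -/
def proj {X : Type u} (p : AlexandroffDuplicate X) : X := p.point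

/-- The layer `X × {i}` of the duplicate. -/
def layer (X : Type u) (i : Bool) : Set (AlexandroffDuplicate X) := {p | p.level = i}

/-- For a point `x` and a subset `U` of `X`, the set `(U × {0, 1}) \ {(x, 1)}`. -/
def basicNhd {X : Type u} (x : X) (U : Set X) : Set (AlexandroffDuplicate X) :=
  {p | p.point ∈ U ∧ p ≠ mk x true}

/-- The topology of the duplicate: the points of `X × {1}` are isolated, and the sets
`(U × {0, 1}) \ {(x, 1)}`, with `U` a neighbourhood of `x`, are the basic neighbourhoods of
`(x, 0)`. -/
instance instTopologicalSpace (X : Type u) [TopologicalSpace X] :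
    TopologicalSpace (AlexandroffDuplicate X) where
  IsOpen W := ∀ x : X, mk x false ∈ W →
    ∃ U ∈ nhds x, basicNhd x U ⊆ W
  isOpen_univ := fun _ _ => ⟨Set.univ, Filter.univ_mem, Set.subset_univ _⟩
  isOpen_inter := by
    intro W₁ W₂ h₁ h₂ x hx
    obtain ⟨U₁, hU₁, hs₁⟩ := h₁ x hx.1
    obtain ⟨U₂, hU₂, hs₂⟩ := h₂ x hx.2
    exact ⟨U₁ ∩ U₂, Filter.inter_mem hU₁ hU₂,
      fun p hp => ⟨hs₁ ⟨hp.1.1, hp.2⟩, hs₂ ⟨hp.1.2, hp.2⟩⟩⟩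
  isOpen_sUnion := by
    intro S hS x hx
    obtain ⟨W, hW, hxW⟩ := hx
    obtain ⟨U, hU, hs⟩ := hS W hW x hxW
    exact ⟨U, hU, fun p hp => ⟨W, hW, hs hp⟩⟩

/-- In a Hausdorff (even `T₁`) space the sets `(U × {0, 1}) \ {(x, 1)}` form a neighbourhood base
at `(x, 0)`. -/
theorem mem_nhds_zero {X : Type u} [TopologicalSpace X] [T1Space X] (x : X)
    (W : Set (AlexandroffDuplicate X)) :
    W ∈ nhds (mk x false) ↔ ∃ U ∈ nhds x, basicNhd x U ⊆ W := by
  rw [mem_nhds_iff]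
  constructor
  · rintro ⟨V, hVW, hV, hx⟩
    obtain ⟨U, hU, hs⟩ := hV x hx
    exact ⟨U, hU, hs.trans hVW⟩
  · rintro ⟨U, hU, hs⟩
    obtain ⟨V, hVU, hV, hxV⟩ := mem_nhds_iff.1 hU
    refine ⟨basicNhd x V, fun p hp => hs ⟨hVU hp.1, hp.2⟩, ?_, hxV, ?_⟩
    · intro y hy
      by_cases hyx : y = x
      · subst hyx
        exact ⟨V, hV.mem_nhds hxV, subset_rfl⟩
      · refine ⟨V ∩ {x}ᶜ, Filter.inter_mem (hV.mem_nhds hy.1)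
          (isOpen_compl_singleton.mem_nhds hyx), fun p hp => ⟨hp.1.1, ?_⟩⟩
        rintro rfl
        exact hp.1.2 rfl
    · intro h
      exact Bool.false_ne_true (congrArg level h)

/-- The points of `X × {1}` are isolated. -/
theorem isOpen_singleton_one {X : Type u} [TopologicalSpace X] (x : X) :
    IsOpen ({mk x true} : Set (AlexandroffDuplicate X)) := by
  intro y hy
  exact absurd (congrArg level hy) Bool.false_ne_true

end AlexandroffDuplicate

/-- The `Σ`-product `Σ(J)` in `ℝ^J`: the points with countable support. -/
def sigmaProduct (J : Type u) : Set (J → ℝ) := {f | {j | f j ≠ 0}.Countable}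

/-- `A` is a `Σ`-subset of `X`: for some homeomorphic embedding `h` of `X` into a power `ℝ^J` of
the real line, `A` consists of the points that `h` sends into `Σ(J)`, that is,
`h(A) = h(X) ∩ Σ(J)`. -/
def IsSigmaSubset {X : Type u} [TopologicalSpace X] (A : Set X) : Prop :=
  ∃ (J : Type u) (h : X → J → ℝ), Topology.IsEmbedding h ∧ A = h ⁻¹' sigmaProduct J

/-- The (compact) space `X` is Corson: it embeds into some `Σ(J)`. -/
def IsCorson (X : Type u) [TopologicalSpace X] : Prop :=
  ∃ (J : Type u) (h : X → J → ℝ), Topology.IsEmbedding h ∧ ∀ x, h x ∈ sigmaProduct J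

/-- The (compact) space `X` is super Valdivia: every point of `X` lies in a dense `Σ`-subset. -/
def IsSuperValdivia (X : Type u) [TopologicalSpace X] : Prop :=
  ∀ x : X, ∃ A : Set X, IsSigmaSubset A ∧ Dense A ∧ x ∈ A

open Filter Topology

/-! On a compact space, an induced space is dense, countably closed (one retraction fixes a given
countable part of it, and its fixed-point set is closed) and countably tight
(`exists_countable_mem_closure`). Hence of two nested induced spaces, the smaller being dense, they
coincide: a point of the larger is in the closure of a countable part of the smaller.

The duplicate forces nesting. Each isolated point `(y, 1)` lies in `Ŷ`, so countable closedness puts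
`(x, 0)` in `Ŷ` whenever `x` accumulates at a countable set; if `x` is isolated in `X`, then `(x,
0)` is isolated too. So `Y` is dense in `X`, and tightness of `Y'` gives `Y' ⊆ Y`. Density also lets
the skeleton of `AD(X)` be restricted to `X`, so `Y` is itself induced, and equality follows.

Dense `Σ`-subsets are induced by restricting the coordinate skeleton of `ℝ^J`, hence all equal `Y`.
If they cover `X`, then `Y = X` is a `Σ`-subset and `X` is Corson. In an uncountable cube, the
`Σ`-subsets centred at `0` and at `1` are dense and different. -/

/-! ### Cosmic spaces -/

theorem IsCosmic.of_isInducing {A : Type u} {B : Type v} [TopologicalSpace A] [TopologicalSpace B]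
    {f : A → B} (hf : IsInducing f) (hB : IsCosmic B) : IsCosmic A := by
  obtain ⟨N, hN, hnet⟩ := hB
  refine ⟨(fun s => f ⁻¹' s) '' N, hN.image _, fun x U hU hx => ?_⟩
  obtain ⟨V, hV, rfl⟩ := hf.isOpen_iff.1 hU
  obtain ⟨M, hM, hxM, hMV⟩ := hnet (f x) V hV hx
  exact ⟨_, ⟨M, hM, rfl⟩, hxM, Set.preimage_mono hMV⟩

theorem IsCosmic.of_surjective {A : Type u} {B : Type v} [TopologicalSpace A] [TopologicalSpace B]
    {f : A → B} (hf : Continuous f) (hs : Function.Surjective f) (hA : IsCosmic A) :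
    IsCosmic B := by
  obtain ⟨N, hN, hnet⟩ := hA
  refine ⟨(fun s => f '' s) '' N, hN.image _, fun y U hU hy => ?_⟩
  obtain ⟨x, rfl⟩ := hs y
  obtain ⟨M, hM, hxM, hMV⟩ := hnet x _ (hU.preimage hf) hy
  exact ⟨_, ⟨M, hM, rfl⟩, ⟨x, hxM, rfl⟩, Set.image_subset_iff.2 hMV⟩

theorem IsCosmic.of_secondCountable (A : Type u) [TopologicalSpace A]
    [SecondCountableTopology A] : IsCosmic A :=
  ⟨_, TopologicalSpace.countable_countableBasis A, fun x U hU hx => by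
    obtain ⟨V, hV, hxV, hVU⟩ :=
      (TopologicalSpace.isBasis_countableBasis A).exists_subset_of_mem_open hx hU
    exact ⟨V, hV, hxV, hVU⟩⟩

/-- Cosmic spaces are hereditarily separable, in the form of a statement about the image of a set
under a map with cosmic range. -/
theorem exists_countable_image_dense {Z : Type u} [TopologicalSpace Z] {f : Z → Z}
    (hf : IsCosmic (Set.range f)) (A : Set Z) :
    ∃ D ⊆ A, D.Countable ∧ f '' A ⊆ closure (f '' D) := by
  obtain ⟨N, hN, hnet⟩ := hf
  let c : Set (Set.range f) → Set Z := fun M => {a | a ∈ A ∧ (⟨f a, a, rfl⟩ : Set.range f) ∈ M}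
  have key : ∀ M : Set (Set.range f), ∃ D ⊆ c M, D.Countable ∧ ((c M).Nonempty → D.Nonempty) := by
    intro M
    by_cases h : (c M).Nonempty
    · obtain ⟨a, ha⟩ := h
      exact ⟨{a}, by simpa using ha, Set.countable_singleton a, fun _ => Set.singleton_nonempty a⟩
    · exact ⟨∅, Set.empty_subset _, Set.countable_empty, fun h' => absurd h' h⟩
  choose D hDc hDn hDne using key
  refine ⟨⋃ M ∈ N, D M, Set.iUnion₂_subset fun M _ => (hDc M).trans fun a ha => ha.1,
    hN.biUnion fun M _ => hDn M, ?_⟩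
  rintro _ ⟨a, ha, rfl⟩
  rw [mem_closure_iff]
  intro U hU haU
  obtain ⟨M, hM, haM, hMU⟩ :=
    hnet ⟨f a, a, rfl⟩ (Subtype.val ⁻¹' U) (hU.preimage continuous_subtype_val) haU
  obtain ⟨d, hd⟩ := hDne M ⟨a, ha, haM⟩
  exact ⟨f d, hMU (hDc M hd).2, d, Set.mem_biUnion hM hd, rfl⟩

/-! ### Density, countable closedness and tightness of induced spaces -/

namespace IsRSkeleton

variable {Z : Type u} [TopologicalSpace Z] {Γ : Type v} [PartialOrder Γ] {r : Γ → Z → Z}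

theorem apply_of_le (hr : IsRSkeleton r) {s t : Γ} (h : s ≤ t) {x : Z} (hx : x ∈ Set.range (r s)) :
    r t x = x := by
  obtain ⟨y, rfl⟩ := hx
  exact congrFun (hr.compatible s t h).2 y

theorem apply_apply_of_le (hr : IsRSkeleton r) {s t : Γ} (h : s ≤ t) (x : Z) :
    r s (r t x) = r s x :=
  congrFun (hr.compatible s t h).1 x

theorem exists_seq_lub (hr : IsRSkeleton r) (s : Γ) (u : ℕ → Γ) :
    ∃ a, s ≤ a ∧ ∀ n, u n ≤ a := by
  choose j hj₁ hj₂ using hr.directed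
  let v : ℕ → Γ := fun n => Nat.rec s (fun n p => j p (u n)) n
  have hv : Monotone v := monotone_nat_of_le_succ fun n => hj₁ _ _
  obtain ⟨a, ha⟩ := hr.sigma_complete v hv
  exact ⟨a, ha.1 ⟨0, rfl⟩, fun n => (hj₂ (v n) (u n)).trans (ha.1 ⟨n + 1, rfl⟩)⟩

theorem exists_fixes_countable (hr : IsRSkeleton r) (s : Γ) {D : Set Z} (hD : D.Countable)
    (hDr : D ⊆ inducedSubspace r) : ∃ t, s ≤ t ∧ ∀ d ∈ D, r t d = d := by
  rcases D.eq_empty_or_nonempty with rfl | hne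
  · exact ⟨s, le_rfl, fun _ h => h.elim⟩
  obtain ⟨d, rfl⟩ := hD.exists_eq_range hne
  have h : ∀ n, ∃ u, d n ∈ Set.range (r u) := fun n => Set.mem_iUnion.1 (hDr ⟨n, rfl⟩)
  choose u hu using h
  obtain ⟨a, hsa, hua⟩ := hr.exists_seq_lub s u
  refine ⟨a, hsa, ?_⟩
  rintro _ ⟨n, rfl⟩
  exact hr.apply_of_le (hua n) (hu n)

theorem isClosed_fixed [T2Space Z] (hr : IsRSkeleton r) (s : Γ) : IsClosed {x | r s x = x} :=
  isClosed_eq (hr.retraction s).1 continuous_id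

theorem mem_induced (hr : IsRSkeleton r) {x : Z} :
    x ∈ inducedSubspace r ↔ ∃ s, r s x = x := by
  refine Set.mem_iUnion.trans (exists_congr fun s => ⟨?_, fun h => ⟨x, h⟩⟩)
  rintro ⟨y, rfl⟩
  exact (hr.retraction s).2 y

/-- The induced space of an `r`-skeleton is countably closed. -/
theorem closure_subset_induced [T2Space Z] (hr : IsRSkeleton r) {D : Set Z} (hD : D.Countable)
    (hDr : D ⊆ inducedSubspace r) : closure D ⊆ inducedSubspace r := by
  obtain ⟨s⟩ := hr.nonempty
  obtain ⟨t, -, ht⟩ := hr.exists_fixes_countable s hD hDr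
  intro x hx
  exact hr.mem_induced.2 ⟨t, closure_minimal ht (hr.isClosed_fixed t) hx⟩

theorem dense_induced (hr : IsRSkeleton r) : Dense (inducedSubspace r) := by
  intro x
  have := hr.nonempty
  have : IsDirectedOrder Γ := ⟨hr.directed⟩
  exact mem_closure_of_tendsto (hr.tendsto_id x)
    (Eventually.of_forall fun s => Set.mem_iUnion.2 ⟨s, x, rfl⟩)

theorem mem_induced_of_isOpen (hr : IsRSkeleton r) {x : Z} (hx : IsOpen {x}) :
    x ∈ inducedSubspace r := by
  obtain ⟨y, rfl, hy⟩ := hr.dense_induced.inter_open_nonempty _ hx (Set.singleton_nonempty x)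
  exact hy

/-- If `A` lies in the induced space and has compact closure, then cofinally many of the
retractions map the closure of `A` into the closure of a countable subset of `A`. -/
theorem exists_maps_closure [T2Space Z] (hr : IsRSkeleton r) {A : Set Z}
    (hA : A ⊆ inducedSubspace r) (hc : IsCompact (closure A)) (s₀ : Γ) :
    ∃ t, s₀ ≤ t ∧ ∃ S ⊆ A, S.Countable ∧ ∀ x ∈ closure A, r t x ∈ closure S := by
  -- Closing-off argument: each `next s` fixes a countable set whose image is dense in that of `A`
  -- under `r s`. At the supremum `t` of the iterates, every point of `closure S` is fixed.
  choose D hDA hDc hD using fun s => exists_countable_image_dense (hr.cosmic s) A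
  choose next hle hfix using fun s => hr.exists_fixes_countable s (hDc s) ((hDA s).trans hA)
  let s : ℕ → Γ := fun n => next^[n] s₀
  have hs : ∀ n, s (n + 1) = next (s n) := fun n => Function.iterate_succ_apply' next n s₀
  have hmono : Monotone s := monotone_nat_of_le_succ fun n => (hs n).symm ▸ hle (s n)
  obtain ⟨t, ht⟩ := hr.sigma_complete s hmono
  have hst : ∀ n, s n ≤ t := fun n => ht.1 ⟨n, rfl⟩
  let S := ⋃ n, D (s n)
  have hSA : S ⊆ A := Set.iUnion_subset fun n => hDA _
  have hSc : IsCompact (closure S) := hc.of_isClosed_subset isClosed_closure (closure_mono hSA)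
  have hSt : ∀ x ∈ closure S, r t x = x := by
    refine closure_minimal (Set.iUnion_subset fun n d hd => ?_) (hr.isClosed_fixed t)
    exact hr.apply_of_le (hs n ▸ hst (n + 1)) ⟨d, hfix (s n) d hd⟩
  refine ⟨t, hst 0, S, hSA, Set.countable_iUnion fun n => hDc _, fun x hx => ?_⟩
  -- These sets decrease because `r (s n)` factors through `r (s (n + 1))`. A common point `d` has
  -- the same image as `x` under every `r (s n)`, hence under `r t`, so `r t x = r t d = d`.
  let C : ℕ → Set Z := fun n => closure S ∩ {d | r (s n) d = r (s n) x}
  have hCc : ∀ n, IsClosed (C n) := fun n =>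
    isClosed_closure.inter (isClosed_eq (hr.retraction _).1 continuous_const)
  have hCne : ∀ n, (C n).Nonempty := by
    intro n
    have hcont := (hr.retraction (s n)).1
    have h₁ : r (s n) x ∈ closure (r (s n) '' D (s n)) :=
      closure_minimal (hD (s n)) isClosed_closure
        (image_closure_subset_closure_image hcont ⟨x, hx, rfl⟩)
    have h₂ : closure (r (s n) '' D (s n)) ⊆ r (s n) '' closure S :=
      closure_minimal (Set.image_mono ((Set.subset_iUnion (fun n => D (s n)) n).trans
        subset_closure)) (hSc.image hcont).isClosed
    obtain ⟨d, hd, hdx⟩ := h₂ h₁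
    exact ⟨d, hd, hdx⟩
  obtain ⟨d, hd⟩ := IsCompact.nonempty_iInter_of_sequence_nonempty_isCompact_isClosed C
    (fun n d hd => ⟨hd.1, by
      have h := congrArg (r (s n)) hd.2
      rwa [hr.apply_apply_of_le (hmono n.le_succ), hr.apply_apply_of_le (hmono n.le_succ)] at h⟩)
    hCne (hSc.of_isClosed_subset (hCc 0) Set.inter_subset_left) hCc
  rw [Set.mem_iInter] at hd
  have hdx : r t d = r t x := tendsto_nhds_unique (hr.tendsto_seq s t hmono ht d)
    ((hr.tendsto_seq s t hmono ht x).congr fun n => ((hd n).2 : r (s n) d = r (s n) x).symm)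
  rw [← hdx, hSt d (hd 0).1]
  exact (hd 0).1

/-- The induced space of an `r`-skeleton on a compact space is countably tight. -/
theorem exists_countable_mem_closure [T2Space Z] [CompactSpace Z] (hr : IsRSkeleton r) {A : Set Z}
    (hA : A ⊆ inducedSubspace r) {y : Z} (hy : y ∈ inducedSubspace r) (hyA : y ∈ closure A) :
    ∃ S ⊆ A, S.Countable ∧ y ∈ closure S := by
  obtain ⟨s, hs⟩ := Set.mem_iUnion.1 hy
  obtain ⟨t, hst, S, hSA, hS, h⟩ := hr.exists_maps_closure hA isClosed_closure.isCompact s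
  exact ⟨S, hSA, hS, hr.apply_of_le hst hs ▸ h y hyA⟩

end IsRSkeleton

/-! ### Small index sets and restriction of skeletons -/

/-- Formal expressions built from generators by binary joins and limits of sequences. -/
inductive SkeletonTerm (A : Type u) : Type u
  | root : SkeletonTerm A
  | leaf : A → SkeletonTerm A
  | join : SkeletonTerm A → SkeletonTerm A → SkeletonTerm A
  | lim : (ℕ → SkeletonTerm A) → SkeletonTerm A

/-- Evaluation of the formal expressions in a set with given operations. -/
def SkeletonTerm.eval {A : Type u} {Γ : Type v} (g : Γ) (f : A → Γ) (j : Γ → Γ → Γ)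
    (l : (ℕ → Γ) → Γ) : SkeletonTerm A → Γ
  | root => g
  | leaf a => f a
  | join s t => j (s.eval g f j l) (t.eval g f j l)
  | lim s => l fun n => (s n).eval g f j l

/-- A cofinal `σ`-closed subset `P` of a directed `σ`-complete order contains a directed `σ`-closed
subset of small cardinality which lies above a given small family. -/
theorem exists_small_sigmaClosed {Γ : Type v} [PartialOrder Γ] [Nonempty Γ]
    (hdir : ∀ s t : Γ, ∃ a, s ≤ a ∧ t ≤ a) (P : Set Γ) (hcof : ∀ s, ∃ t ∈ P, s ≤ t)
    (hsup : ∀ (s : ℕ → Γ) (a : Γ), Monotone s → IsLUB (Set.range s) a → (∀ n, s n ∈ P) → a ∈ P)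
    {A : Type u} (f : A → Γ) :
    ∃ (Γ' : Type u) (_ : PartialOrder Γ') (e : Γ' ↪o Γ), Nonempty Γ' ∧
      (∀ s t : Γ', ∃ a, s ≤ a ∧ t ≤ a) ∧ (∀ s, e s ∈ P) ∧
      (∀ (s : ℕ → Γ') (a : Γ), Monotone s → IsLUB (Set.range (e ∘ s)) a → ∃ b, e b = a) ∧
      ∀ a, ∃ b, f a ≤ e b := by
  classical
  choose up hupP hup using hcof
  choose j₀ hj₁ hj₂ using hdir
  let g : Γ := up (Classical.arbitrary Γ)
  -- The default `g` lies in `P`, so evaluations stay in `P` even at sequences that are not monotone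
  -- or have no supremum.
  let l : (ℕ → Γ) → Γ := fun s =>
    if h : Monotone s ∧ ∃ a, IsLUB (Set.range s) a then h.2.choose else g
  let ev : SkeletonTerm A → Γ :=
    SkeletonTerm.eval g (fun a => up (f a)) (fun s t => up (j₀ s t)) l
  have hP : ∀ T, ev T ∈ P := by
    intro T
    induction T with
    | root => exact hupP _
    | leaf a => exact hupP _
    | join s t _ _ => exact hupP _
    | lim s ih =>
      change l (fun n => ev (s n)) ∈ P
      by_cases h : Monotone (fun n => ev (s n)) ∧ ∃ a, IsLUB (Set.range fun n => ev (s n)) a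
      · simp only [l, dif_pos h]
        exact hsup _ _ h.1 h.2.choose_spec ih
      · simp only [l, dif_neg h]
        exact hupP _
  -- The terms over `A` live in the universe of `A`, which bounds the size of the set of their
  -- values whatever the universe of `Γ`.
  have : Small.{u} (Set.range ev) := small_range ev
  let i : Shrink.{u} (Set.range ev) → Γ := fun x => ((equivShrink _).symm x).1
  have hi : Function.Injective i := Subtype.val_injective.comp (Equiv.injective _)
  have hirange : ∀ T, ∃ b, i b = ev T := fun T => ⟨equivShrink _ ⟨ev T, T, rfl⟩, by simp [i]⟩
  have hiev : ∀ b, ∃ T, ev T = i b := fun b => ((equivShrink _).symm b).2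
  let po : PartialOrder (Shrink.{u} (Set.range ev)) := PartialOrder.lift i hi
  let e : Shrink.{u} (Set.range ev) ↪o Γ := ⟨⟨i, hi⟩, Iff.rfl⟩
  refine ⟨Shrink.{u} (Set.range ev), po, e, ?_, ?_, ?_, ?_, ?_⟩
  · obtain ⟨b, -⟩ := hirange SkeletonTerm.root
    exact ⟨b⟩
  · intro s t
    obtain ⟨S, hS⟩ := hiev s
    obtain ⟨T, hT⟩ := hiev t
    obtain ⟨b, hb⟩ := hirange (S.join T)
    have hb' : i b = up (j₀ (i s) (i t)) := by rw [hb, ← hS, ← hT]; rfl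
    exact ⟨b, ((hj₁ _ _).trans (hup _)).trans_eq hb'.symm,
      ((hj₂ _ _).trans (hup _)).trans_eq hb'.symm⟩
  · intro s
    obtain ⟨T, hT⟩ := hiev s
    exact (show ev T = e s from hT) ▸ hP T
  · intro s a hs ha
    choose T hT using fun n => hiev (s n)
    obtain ⟨b, hb⟩ := hirange (SkeletonTerm.lim T)
    refine ⟨b, ?_⟩
    have hl : ev (SkeletonTerm.lim T) = l (fun n => i (s n)) := by
      change l (fun n => ev (T n)) = _
      simp only [hT]
    have h : Monotone (fun n => i (s n)) ∧ ∃ a, IsLUB (Set.range fun n => i (s n)) a :=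
      ⟨fun m n hmn => hs hmn, a, ha⟩
    change i b = a
    rw [hb, hl]
    simp only [l, dif_pos h]
    exact h.2.choose_spec.unique ha
  · intro a
    obtain ⟨b, hb⟩ := hirange (SkeletonTerm.leaf a)
    exact ⟨b, (hup (f a)).trans_eq hb.symm⟩

/-- An `r`-skeleton pulls back along an embedding of a compact space onto a subspace in which the
induced space is dense. -/
theorem IsRSkeleton.exists_pullback {X : Type w} {Z : Type u} [TopologicalSpace X] [CompactSpace X]
    [TopologicalSpace Z] [T2Space Z] {Γ : Type v} [PartialOrder Γ] {R : Γ → Z → Z}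
    (hR : IsRSkeleton R) {h : X → Z} (hh : IsEmbedding h)
    (hd : Dense (h ⁻¹' inducedSubspace R)) :
    ∃ (Γ' : Type u) (_ : PartialOrder Γ') (r : Γ' → X → X), IsRSkeleton r ∧
      inducedSubspace r = h ⁻¹' inducedSubspace R := by
  have := hR.nonempty
  have hcl : IsClosed (Set.range h) := (isCompact_range hh.continuous).isClosed
  let P : Set Γ := {t | ∀ x, R t (h x) ∈ Set.range h}
  -- By density, `range h` lies in the closure of the induced points it contains; cofinally many
  -- retractions map that closure into itself.
  have hcof : ∀ s, ∃ t ∈ P, s ≤ t := by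
    intro s
    have hsub : h '' (h ⁻¹' inducedSubspace R) ⊆ Set.range h := Set.image_subset_range _ _
    obtain ⟨t, hst, S, hS, -, ht⟩ := hR.exists_maps_closure
      (Set.image_preimage_subset h (inducedSubspace R))
      ((isCompact_range hh.continuous).of_isClosed_subset isClosed_closure
        (closure_minimal hsub hcl)) s
    exact ⟨t, fun x => closure_minimal (hS.trans hsub) hcl
      (ht _ (image_closure_subset_closure_image hh.continuous ⟨x, hd x, rfl⟩)), hst⟩
  have hsup : ∀ (s : ℕ → Γ) (a : Γ), Monotone s → IsLUB (Set.range s) a →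
      (∀ n, s n ∈ P) → a ∈ P := fun s a hs ha hP x =>
    hcl.mem_of_tendsto (hR.tendsto_seq s a hs ha (h x)) (Eventually.of_forall fun n => hP n x)
  -- The seeds are pairs of a point and a neighbourhood: keeping an index above each of them
  -- preserves both the induced space and convergence to the identity in the small index set.
  have hseed : ∀ p : Z × Set Z, ∃ s, (p.1 ∈ inducedSubspace R → R s p.1 = p.1) ∧
      (p.2 ∈ 𝓝 p.1 → ∀ t, s ≤ t → R t p.1 ∈ p.2) := by
    rintro ⟨z, U⟩
    have h₁ : ∃ s, z ∈ inducedSubspace R → R s z = z := by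
      by_cases hz : z ∈ inducedSubspace R
      · exact (hR.mem_induced.1 hz).imp fun s hs _ => hs
      · exact ⟨Classical.arbitrary Γ, fun h => absurd h hz⟩
    have h₂ : ∃ s, U ∈ 𝓝 z → ∀ t, s ≤ t → R t z ∈ U := by
      by_cases hU : U ∈ 𝓝 z
      · have : IsDirectedOrder Γ := ⟨hR.directed⟩
        exact (eventually_atTop.1 (hR.tendsto_id z hU)).imp fun s hs _ => hs
      · exact ⟨Classical.arbitrary Γ, fun h => absurd h hU⟩
    obtain ⟨s₁, hs₁⟩ := h₁
    obtain ⟨s₂, hs₂⟩ := h₂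
    obtain ⟨a, ha₁, ha₂⟩ := hR.directed s₁ s₂
    exact ⟨a, fun hz => hR.apply_of_le ha₁ ⟨z, hs₁ hz⟩, fun hU t ht => hs₂ hU t (ha₂.trans ht)⟩
  choose f hf₁ hf₂ using hseed
  obtain ⟨Γ', po, e, hne, hdir, heP, hesup, hef⟩ :=
    exists_small_sigmaClosed hR.directed P hcof hsup f
  choose r hr using heP
  have hrange : ∀ s x, h x = R (e s) (h x) → r s x = x := fun s x hx =>
    hh.injective ((hr s x).trans hx.symm)
  have hlub : ∀ s : ℕ → Γ', Monotone s →
      ∃ c, IsLUB (Set.range s) c ∧ IsLUB (Set.range (e ∘ s)) (e c) := by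
    intro s hs
    obtain ⟨b, hb⟩ := hR.sigma_complete (e ∘ s) (e.monotone.comp hs)
    obtain ⟨c, rfl⟩ := hesup s b hs hb
    exact ⟨c, .of_image e.le_iff_le (Set.range_comp e s ▸ hb), hb⟩
  refine ⟨Γ', po, r, ⟨hne, hdir, ?_, ?_, ?_, ?_, ?_, ?_⟩, ?_⟩
  · exact fun s hs => (hlub s hs).imp fun _ h => h.1
  · refine fun s => ⟨hh.continuous_iff.2 ?_, fun x => hrange s _ ?_⟩
    · exact ((hR.retraction (e s)).1.comp hh.continuous).congr fun x => (hr s x).symm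
    · rw [hr, (hR.retraction (e s)).2]
  · intro s
    have hm : ∀ x : Set.range (r s), h x ∈ Set.range (R (e s)) := by
      rintro ⟨_, x, rfl⟩
      exact ⟨h x, (hr s x).symm⟩
    refine IsCosmic.of_isInducing
      (f := fun x : Set.range (r s) => (⟨h x, hm x⟩ : Set.range (R (e s)))) ?_ (hR.cosmic (e s))
    exact IsInducing.of_comp (by fun_prop) continuous_subtype_val
      (hh.isInducing.comp IsInducing.subtypeVal)
  · intro s t hst
    refine ⟨funext fun x => hh.injective ?_, funext fun x => hh.injective ?_⟩
    · simp only [Function.comp_apply, hr]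
      exact hR.apply_apply_of_le (e.monotone hst) _
    · simp only [Function.comp_apply, hr]
      exact hR.apply_of_le (e.monotone hst) ⟨_, rfl⟩
  · intro s a hs ha x
    obtain ⟨c, hc, hec⟩ := hlub s hs
    rw [ha.unique hc, hh.tendsto_nhds_iff, hr]
    exact (hR.tendsto_seq _ _ (e.monotone.comp hs) hec (h x)).congr
      fun n => (hr (s n) x).symm
  · intro x
    rw [hh.tendsto_nhds_iff]
    intro U hU
    obtain ⟨b, hb⟩ := hef (h x, U)
    refine mem_map.2 (mem_of_superset (mem_atTop b) fun s hs => ?_)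
    change h (r s x) ∈ U
    rw [hr]
    exact hf₂ (h x, U) hU _ (hb.trans (e.monotone hs))
  · ext x
    simp only [inducedSubspace, Set.mem_iUnion, Set.mem_preimage]
    constructor
    · rintro ⟨s, y, rfl⟩
      exact ⟨e s, h y, (hr s y).symm⟩
    · intro hx
      obtain ⟨b, hb⟩ := hef (h x, Set.univ)
      have := hf₁ (h x, Set.univ) (Set.mem_iUnion.2 hx)
      exact ⟨b, x, hrange b x (hR.apply_of_le hb ⟨_, this⟩).symm⟩

/-! ### The coordinate skeleton of `ℝ^J` and dense `Σ`-subsets -/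

/-- The projection of `ℝ^J` which sets the coordinates outside `I` to zero. -/
noncomputable def coordinateRestriction {J : Type u} (I : Set J) (f : J → ℝ) : J → ℝ :=
  I.indicator f

theorem continuous_coordinateRestriction {J : Type u} (I : Set J) :
    Continuous (coordinateRestriction I) := by
  classical
  refine continuous_pi fun j => ?_
  by_cases hj : j ∈ I
  · simpa [coordinateRestriction, hj] using continuous_apply j
  · simpa [coordinateRestriction, hj] using continuous_const

theorem isCosmic_range_coordinateRestriction {J : Type u} {I : Set J} (hI : I.Countable) :
    IsCosmic (Set.range (coordinateRestriction I)) := by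
  classical
  have := hI.to_subtype
  let g : (I → ℝ) → J → ℝ := fun f j => if hj : j ∈ I then f ⟨j, hj⟩ else 0
  have hg : Continuous g := by
    refine continuous_pi fun j => ?_
    by_cases hj : j ∈ I
    · simpa [g, hj] using continuous_apply _
    · simpa [g, hj] using continuous_const
  have hgm : ∀ f, g f ∈ Set.range (coordinateRestriction I) := by
    refine fun f => ⟨g f, funext fun j => ?_⟩
    by_cases hj : j ∈ I <;> simp [coordinateRestriction, g, hj]
  refine IsCosmic.of_surjective (f := fun f => (⟨g f, hgm f⟩ : Set.range (coordinateRestriction I)))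
    (hg.subtype_mk hgm) ?_ (IsCosmic.of_secondCountable (I → ℝ))
  rintro ⟨_, f, rfl⟩
  refine ⟨fun j => f j, Subtype.ext (funext fun j => ?_)⟩
  by_cases hj : j ∈ I <;> simp [coordinateRestriction, g, hj]

/-- The projections onto countable sets of coordinates form an `r`-skeleton on `ℝ^J`. -/
theorem isRSkeleton_coordinateRestriction (J : Type u) :
    IsRSkeleton (fun I : {I : Set J // I.Countable} => coordinateRestriction I.1) := by
  have hlub : ∀ s : ℕ → {I : Set J // I.Countable},
      IsLUB (Set.range s) ⟨⋃ n, (s n).1, Set.countable_iUnion fun n => (s n).2⟩ := by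
    refine fun s => ⟨?_, fun a ha => Set.iUnion_subset fun n => ha ⟨n, rfl⟩⟩
    rintro _ ⟨n, rfl⟩
    exact Set.subset_iUnion (fun n => (s n).1) n
  refine ⟨⟨⟨∅, Set.countable_empty⟩⟩, fun s t => ⟨⟨s.1 ∪ t.1, s.2.union t.2⟩,
    Set.subset_union_left, Set.subset_union_right⟩, fun s _ => ⟨_, hlub s⟩, fun s => ?_,
    fun s => isCosmic_range_coordinateRestriction s.2, fun s t hst => ?_, fun s a hs ha x => ?_,
    fun x => ?_⟩
  · exact ⟨continuous_coordinateRestriction _, fun f => by simp [coordinateRestriction]⟩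
  · have h : s.1 ⊆ t.1 := hst
    constructor <;> funext f
    · simp [coordinateRestriction, Set.indicator_indicator, Set.inter_eq_left.2 h]
    · simp [coordinateRestriction, Set.indicator_indicator, Set.inter_eq_right.2 h]
  · rw [ha.unique (hlub s), tendsto_pi_nhds]
    intro j
    apply tendsto_const_nhds.congr'
    by_cases hj : j ∈ ⋃ n, (s n).1
    · obtain ⟨n, hn⟩ := Set.mem_iUnion.1 hj
      filter_upwards [mem_atTop n] with m hm
      have hjm : j ∈ (s m).1 := hs hm hn
      simp only [coordinateRestriction, Set.indicator_of_mem hj, Set.indicator_of_mem hjm]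
    · refine Eventually.of_forall fun m => ?_
      have hjm : j ∉ (s m).1 := fun h => hj (Set.mem_iUnion.2 ⟨m, h⟩)
      simp only [coordinateRestriction, Set.indicator_of_notMem hj, Set.indicator_of_notMem hjm]
  · rw [tendsto_pi_nhds]
    intro j
    apply tendsto_const_nhds.congr'
    filter_upwards [mem_atTop (⟨{j}, Set.countable_singleton j⟩ : {I : Set J // I.Countable})]
      with I hI
    have hj : j ∈ I.1 := hI rfl
    simp only [coordinateRestriction, Set.indicator_of_mem hj]

theorem inducedSubspace_coordinateRestriction (J : Type u) :
    inducedSubspace (fun I : {I : Set J // I.Countable} => coordinateRestriction I.1) =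
      sigmaProduct J := by
  ext f
  simp only [inducedSubspace, Set.mem_iUnion]
  constructor
  · rintro ⟨I, g, rfl⟩
    exact I.2.mono fun j hj => by
      by_contra hjI
      exact hj (Set.indicator_of_notMem hjI g)
  · intro hf
    refine ⟨⟨_, hf⟩, f, ?_⟩
    exact Set.indicator_eq_self.2 fun j hj => hj

/-- A dense `Σ`-subset of a compact space is induced by an `r`-skeleton. -/
theorem IsSigmaSubset.exists_rSkeleton {X : Type u} [TopologicalSpace X] [CompactSpace X]
    {A : Set X} (hA : IsSigmaSubset A) (hd : Dense A) :
    ∃ (Γ' : Type u) (_ : PartialOrder Γ') (r : Γ' → X → X), IsRSkeleton r ∧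
      inducedSubspace r = A := by
  obtain ⟨J, h, hh, rfl⟩ := hA
  rw [← inducedSubspace_coordinateRestriction] at hd ⊢
  exact (isRSkeleton_coordinateRestriction J).exists_pullback hh hd

/-! ### Skeletons on the Alexandroff duplicate -/

namespace AlexandroffDuplicate

theorem proj_image_eq {X : Type u} (A : Set (AlexandroffDuplicate X)) :
    proj '' (A ∩ layer X false) = (fun x => mk x false) ⁻¹' A := by
  ext x
  constructor
  · rintro ⟨⟨y, i⟩, ⟨hA, hi⟩, rfl⟩
    obtain rfl : i = false := hi
    exact hA
  · exact fun h => ⟨mk x false, ⟨h, rfl⟩, rfl⟩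

variable {X : Type u} [TopologicalSpace X]

theorem continuous_proj : Continuous (proj : AlexandroffDuplicate X → X) :=
  continuous_def.2 fun U hU _ hx => ⟨U, hU.mem_nhds hx, fun _ hp => hp.1⟩

theorem continuous_mk_false : Continuous (fun x : X => mk x false) := by
  refine continuous_def.2 fun W hW => isOpen_iff_mem_nhds.2 fun x hx => ?_
  obtain ⟨U, hU, hUW⟩ := hW x hx
  exact mem_of_superset hU fun y hy => hUW ⟨hy, fun h => Bool.false_ne_true (congrArg level h)⟩

theorem isEmbedding_mk_false : IsEmbedding (fun x : X => mk x false) :=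
  IsEmbedding.of_comp continuous_mk_false continuous_proj IsEmbedding.id

instance instT2Space [T2Space X] : T2Space (AlexandroffDuplicate X) := by
  refine T2Space.mk fun p q hpq => ?_
  by_cases h : p.point = q.point
  · have hc : ∀ x : X, IsOpen ({mk x true}ᶜ : Set (AlexandroffDuplicate X)) := by
      intro x y hy
      by_cases hyx : y = x
      · exact ⟨Set.univ, univ_mem, fun p hp h => hp.2 (hyx ▸ h)⟩
      · exact ⟨{x}ᶜ, isOpen_compl_singleton.mem_nhds hyx, fun p hp h => hp.1 (congrArg point h)⟩
    obtain ⟨x, i⟩ := p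
    obtain ⟨y, j⟩ := q
    obtain rfl : x = y := h
    cases i <;> cases j
    · exact absurd rfl hpq
    · exact ⟨_, _, hc x, isOpen_singleton_one x, hpq, rfl, disjoint_compl_left⟩
    · exact ⟨_, _, isOpen_singleton_one x, hc x, rfl, hpq.symm, disjoint_compl_right⟩
    · exact absurd rfl hpq
  · exact separated_by_continuous continuous_proj h

variable [T2Space X] {Γ : Type v} [PartialOrder Γ]
  {R : Γ → AlexandroffDuplicate X → AlexandroffDuplicate X}

/-- For `x` isolated, `basicNhd x {x}` reduces to `(x, 0)`, and a dense set contains every isolated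
point. -/
theorem mem_induced_of_isOpen_singleton (hR : IsRSkeleton R) {x : X} (hx : IsOpen {x}) :
    mk x false ∈ inducedSubspace R := by
  obtain ⟨q, ⟨hq, hqt⟩, hqR⟩ := mem_closure_iff_nhds.1 (hR.dense_induced (mk x false))
    (basicNhd x {x}) ((mem_nhds_zero x _).2 ⟨_, hx.mem_nhds rfl, subset_rfl⟩)
  obtain ⟨y, i⟩ := q
  obtain rfl : y = x := hq
  cases i
  · exact hqR
  · exact absurd rfl hqt

/-- If the duplicate has an `r`-skeleton, then every accumulation point of a countable set of
points of the space lies, in the bottom layer, in the induced space. -/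
theorem mem_induced_of_accPt (hR : IsRSkeleton R) {S : Set X} (hS : S.Countable) {x : X}
    (hx : AccPt x (𝓟 S)) : mk x false ∈ inducedSubspace R := by
  refine hR.closure_subset_induced (hS.image fun y => mk y true) ?_ ?_
  · rintro _ ⟨y, -, rfl⟩
    exact hR.mem_induced_of_isOpen (isOpen_singleton_one y)
  · refine mem_closure_iff_nhds.2 fun W hW => ?_
    obtain ⟨U, hU, hUW⟩ := (mem_nhds_zero x W).1 hW
    obtain ⟨y, ⟨hyU, hyS⟩, hyx⟩ := accPt_iff_nhds.1 hx U hU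
    exact ⟨mk y true, hUW ⟨hyU, fun h => hyx (congrArg point h)⟩, y, hyS, rfl⟩

/-- An open set with no isolated point of `X` contains an infinite compact set, hence an
accumulation point of a countable set. -/
theorem dense_preimage_induced [CompactSpace X] (hR : IsRSkeleton R) :
    Dense ((fun x => mk x false) ⁻¹' inducedSubspace R) := by
  refine dense_iff_inter_open.2 fun U hU ⟨x, hx⟩ => ?_
  by_cases hiso : ∃ y ∈ U, IsOpen {y}
  · obtain ⟨y, hy, hyo⟩ := hiso
    exact ⟨y, hy, mem_induced_of_isOpen_singleton hR hyo⟩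
  push Not at hiso
  obtain ⟨V, hV, hVc, hVU⟩ := exists_mem_nhds_isClosed_subset (hU.mem_nhds hx)
  have hinf : V.Infinite := by
    intro hfin
    have : (𝓝[≠] x).NeBot := by
      rw [neBot_iff]
      exact fun h => hiso x hx ((isOpen_singleton_iff_punctured_nhds x).2 h)
    exact infinite_of_mem_nhds x hV hfin
  obtain ⟨S, hSV, hSinf, hS⟩ : ∃ S ⊆ V, S.Infinite ∧ S.Countable :=
    ⟨Set.range fun n => (hinf.natEmbedding V n : X), by
        rintro _ ⟨n, rfl⟩
        exact (hinf.natEmbedding V n).2,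
      Set.infinite_range_of_injective (Subtype.val_injective.comp (hinf.natEmbedding V).injective),
      Set.countable_range _⟩
  obtain ⟨y, hyV, hy⟩ := hSinf.exists_accPt_of_subset_isCompact hVc.isCompact hSV
  exact ⟨y, hVU hyV, mem_induced_of_accPt hR hS hy⟩

theorem exists_rSkeleton [CompactSpace X] (hR : IsRSkeleton R) :
    ∃ (Γ' : Type u) (_ : PartialOrder Γ') (r : Γ' → X → X), IsRSkeleton r ∧
      inducedSubspace r = (fun x => mk x false) ⁻¹' inducedSubspace R :=
  hR.exists_pullback isEmbedding_mk_false (dense_preimage_induced hR)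

/-- If the duplicate of a compact space has an `r`-skeleton, then all `r`-skeletons on the space
have the same induced space. -/
theorem induced_eq [CompactSpace X] (hR : IsRSkeleton R) {Γ' : Type w} [PartialOrder Γ']
    {r : Γ' → X → X} (hr : IsRSkeleton r) :
    inducedSubspace r = (fun x => mk x false) ⁻¹' inducedSubspace R := by
  have hsub : inducedSubspace r ⊆ (fun x => mk x false) ⁻¹' inducedSubspace R := by
    intro y hy
    by_cases hiso : IsOpen {y}
    · exact mem_induced_of_isOpen_singleton hR hiso
    have hcl : y ∈ closure (inducedSubspace r \ {y}) := by
      rw [Set.sdiff_eq, Set.inter_comm]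
      exact closure_minimal
        (hr.dense_induced.open_subset_closure_inter isOpen_compl_singleton) isClosed_closure
        (dense_compl_singleton_iff_not_open.2 hiso y)
    obtain ⟨S, hSr, hS, hyS⟩ := hr.exists_countable_mem_closure Set.sdiff_subset hy hcl
    refine mem_induced_of_accPt hR hS (accPt_iff_nhds.2 fun U hU => ?_)
    obtain ⟨z, hzU, hzS⟩ := mem_closure_iff_nhds.1 hyS U hU
    exact ⟨z, ⟨hzU, hzS⟩, (hSr hzS).2⟩
  -- For the reverse inclusion, tightness comes from the restricted skeleton `r₀` and countable
  -- closedness from `r`.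
  refine hsub.antisymm fun y hy => ?_
  obtain ⟨Γ₀, _, r₀, hr₀, h₀⟩ := exists_rSkeleton hR
  rw [← h₀] at hsub hy
  obtain ⟨S, hSr, hS, hyS⟩ := hr₀.exists_countable_mem_closure hsub hy (hr.dense_induced y)
  exact hr.closure_subset_induced hS hSr hyS

end AlexandroffDuplicate

/-! ### Super Valdivia spaces and cubes -/

theorem IsCorson.of_isSuperValdivia {X : Type u} [TopologicalSpace X] [CompactSpace X] [T2Space X]
    {Γ : Type v} [PartialOrder Γ] {R : Γ → AlexandroffDuplicate X → AlexandroffDuplicate X}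
    (hR : IsRSkeleton R) (hX : IsSuperValdivia X) : IsCorson X := by
  have heq : ∀ A : Set X, IsSigmaSubset A → Dense A →
      A = (fun x => AlexandroffDuplicate.mk x false) ⁻¹' inducedSubspace R := by
    intro A hA hd
    obtain ⟨_, _, r, hr, rfl⟩ := hA.exists_rSkeleton hd
    exact AlexandroffDuplicate.induced_eq hR hr
  -- An empty space has no point from which to obtain a `Σ`-subset.
  rcases isEmpty_or_nonempty X with hE | ⟨⟨x⟩⟩
  · exact ⟨PEmpty, fun x => isEmptyElim x, .of_subsingleton _, fun x => isEmptyElim x⟩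
  · obtain ⟨A, hA, hd, -⟩ := hX x
    obtain ⟨J, h, hh, hAh⟩ := id hA
    refine ⟨J, h, hh, fun y => ?_⟩
    obtain ⟨B, hB, hdB, hy⟩ := hX y
    rw [heq B hB hdB, ← heq A hA hd, hAh] at hy
    exact hy

/-- Translating by `-c` carries the centre `c` to the origin of `ℝ^κ`. -/
theorem isSigmaSubset_cube {κ : Type u} (c : κ → unitInterval) :
    IsSigmaSubset {y : κ → unitInterval | {j | y j ≠ c j}.Countable} := by
  refine ⟨κ, fun y j => (y j : ℝ) - c j, ?_, ?_⟩
  · refine IsEmbedding.of_comp (g := fun f : κ → ℝ => fun j => f j + c j) (by fun_prop)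
      (by fun_prop) ?_
    have : (fun f : κ → ℝ => fun j => f j + (c j : ℝ)) ∘
        (fun (y : κ → unitInterval) j => (y j : ℝ) - c j) = fun y j => (y j : ℝ) := by
      funext y j
      simp
    rw [this]
    exact IsEmbedding.piMap fun _ => IsEmbedding.subtypeVal
  · ext y
    simp [sigmaProduct, sub_eq_zero, Subtype.ext_iff]

theorem dense_sigmaSubset_cube {κ : Type u} (c : κ → unitInterval) :
    Dense {y : κ → unitInterval | {j | y j ≠ c j}.Countable} := by
  classical
  refine dense_iff_inter_open.2 fun U hU ⟨x, hx⟩ => ?_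
  obtain ⟨I, V, hV, hVU⟩ := isOpen_pi_iff.1 hU x hx
  refine ⟨fun j => if j ∈ I then x j else c j, hVU fun j hj => ?_, ?_⟩
  · simpa [Finset.mem_coe.1 hj] using (hV j hj).2
  · refine I.countable_toSet.mono fun j hj => ?_
    by_contra hjI
    exact hj (if_neg hjI)

theorem AlexandroffDuplicate.not_isRSkeleton_cube {κ : Type u}
    (hκ : Cardinal.aleph 1 ≤ Cardinal.mk κ) {Γ : Type v} [PartialOrder Γ]
    (R : Γ → AlexandroffDuplicate (κ → unitInterval) → AlexandroffDuplicate (κ → unitInterval)) :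
    ¬ IsRSkeleton R := by
  intro hR
  have heq : ∀ c : κ → unitInterval, {y : κ → unitInterval | {j | y j ≠ c j}.Countable} =
      (fun x => mk x false) ⁻¹' inducedSubspace R := by
    intro c
    obtain ⟨_, _, r, hr, h⟩ := (isSigmaSubset_cube c).exists_rSkeleton (dense_sigmaSubset_cube c)
    rw [← h]
    exact induced_eq hR hr
  -- The `Σ`-subsets centred at `0` and `1` coincide, so the constants `0` and `1` differ at only
  -- countably many coordinates.
  have h : (fun _ => 0 : κ → unitInterval) ∈
      {y : κ → unitInterval | {j | y j ≠ (fun _ => 1 : κ → unitInterval) j}.Countable} := by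
    rw [heq, ← heq fun _ => 0]
    simp
  have huniv : (Set.univ : Set κ).Countable := h.mono fun j _ => zero_ne_one
  have hle : Cardinal.mk κ ≤ Cardinal.aleph0 :=
    Cardinal.mk_le_aleph0_iff.2 (Set.countable_univ_iff.1 huniv)
  exact absurd (hκ.trans hle) (not_le.2 Cardinal.aleph0_lt_aleph_one)

theorem mainTheorem4 :
    (∀ (X : Type u) [TopologicalSpace X] [CompactSpace X] [T2Space X]
      (Γ : Type v) [PartialOrder Γ] (R : Γ → AlexandroffDuplicate X → AlexandroffDuplicate X),
      IsRSkeleton R →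
        (∃ (Γ' : Type u) (_ : PartialOrder Γ') (r : Γ' → X → X), IsRSkeleton r ∧
          inducedSubspace r = AlexandroffDuplicate.proj ''
            (inducedSubspace R ∩ AlexandroffDuplicate.layer X false)) ∧
        (∀ (Γ' : Type w) [PartialOrder Γ'] (r : Γ' → X → X), IsRSkeleton r →
          inducedSubspace r = AlexandroffDuplicate.proj ''
            (inducedSubspace R ∩ AlexandroffDuplicate.layer X false)) ∧
        (¬ IsCorson X → ¬ IsSuperValdivia X)) ∧
    (∀ κ : Type u, Cardinal.aleph 1 ≤ Cardinal.mk κ →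
      ∀ (Γ : Type v) [PartialOrder Γ]
        (R : Γ → AlexandroffDuplicate (κ → unitInterval) →
          AlexandroffDuplicate (κ → unitInterval)),
        ¬ IsRSkeleton R) := by
  refine ⟨fun X _ _ _ Γ _ R hR => ?_, fun κ hκ Γ _ R =>
    AlexandroffDuplicate.not_isRSkeleton_cube hκ R⟩
  rw [AlexandroffDuplicate.proj_image_eq]
  exact ⟨AlexandroffDuplicate.exists_rSkeleton hR,
    fun Γ' _ r hr => AlexandroffDuplicate.induced_eq hR hr,
    mt (IsCorson.of_isSuperValdivia hR)⟩
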